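/- Let $M$ be a smooth manifold of dimension $m+1$ with a smooth Riemannian metric $a=\langle\cdot,\cdot\rangle$ and a smooth 1-form $\beta$ with $\|\beta\|_\alpha<1$, where $\|\beta\|_\alpha=\langle\beta^\sharp,\beta^\sharp\rangle^{1/2}$ and $\langle\beta^\sharp,u\rangle=\beta(u)$. Let $F(y)=\sqrt{\langle y,y\rangle}+\beta(y)$ be the Randers metric and, for $y\neq0$, $g_y(u,v)=\frac12\frac{\partial^2}{\partial s\,\partial t}F^2(y+su+tv)|_{s=t=0}$. Let $\mathcal F$ be a transversally oriented smooth codimension-one foliation of $M$ with smooth unit $a$-normal field $N$, and assume $\beta(N)=0$ on $M$. Let $n$ be the vector field with $\langle n,n\rangle=1$, $\langle n,N\rangle>0$ and $g_n(n,w)=0$ for all $w\in T\mathcal F$. Put $g=g_n$, $\nu=n/F(n)$ and $c=(1-\|\beta\|_\alpha^2)^{1/2}$, and let $\bar\nabla$, $\nabla$ be the Levi-Civita connections of $a$ and $g$. For $u\in T\mathcal F$ put $\bar A(u)=-\bar\nabla_uN$ and $A^g(u)=-\nabla_u\nu$; further let $\bar Z=\bar\nabla_NN$, $2\,\overline{\rm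 Def}_{\xi}=\bar\nabla\xi+(\bar\nabla\xi)^t$ (where $(\bar\nabla \xi)(v)=\bar\nabla_v\xi$ and ${}^t$ is the $a$-conjugate), let ${}^\top$ be the $a$-orthogonal projection to $T\mathcal F$, $v^\flat=\langle v,\cdot\rangle$, $(\omega\otimes X)(u)=(X\otimes\omega)(u)=\omega(u)X$ for a 1-form $\omega$ and a vector $X$, and $\bar A(\beta^\sharp)^{\bot\beta}=\bar A(\beta^\sharp)-\langle\bar A(\beta^\sharp),\beta^\sharp\rangle\,\|\beta\|_\alpha^{-2}\,\beta^\sharp$ (which is $0$ where $\beta=0$). Then on $T\mathcal F$ $$c\,A^g=\bar A-c^{-2}(cN-\beta^\sharp)(c)\,{\rm id}+c^{-1}(\overline{\rm Def}_{\beta^\sharp})^\top_{|T\mathcal F}+U_1^\flat\otimes\beta^\sharp+U_2\otimes\beta,$$ where $$U_1=-\tfrac12c^{-2}\big((cN-\beta^\sharp)(c)\,\beta^\sharp-2c^{-1}(\overline{\rm Def}_{\beta^\sharp}\beta^\sharp)^\top-(\bar\nabla_{N-c^{-1}\beta^\sharp}\beta^\sharp)^\top+c\bar Z+c\,\beta(\bar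 Z)\beta^\sharp-\bar A(\beta^\sharp)^{\bot\beta}\big),$$ $$U_2=\tfrac12\big((\bar\nabla_{N-c^{-1}\beta^\sharp}\beta^\sharp)^\top-c\bar Z-\bar A(\beta^\sharp)^{\bot\beta}\big).$$ Moreover, if $\|\beta\|_\alpha$ is constant, then on $T\mathcal F$ $$c\,A^g=\bar A+c^{-1}(\overline{\rm Def}_{\beta^\sharp})^\top_{|T\mathcal F}+\tfrac12\big((\bar\nabla_{N-c^{-1}\beta^\sharp}\beta^\sharp)^\top-c\bar Z-\bar A(\beta^\sharp)^{\bot\beta}\big)\otimes\beta$$ $$\qquad+\tfrac12c^{-2}\big(2c^{-1}(\overline{\rm Def}_{\beta^\sharp}\beta^\sharp)^\top+(\bar\nabla_{N-c^{-1}\beta^\sharp}\beta^\sharp)^\top+\bar A(\beta^\sharp)^{\bot\beta}-c\bar Z-c\langle\bar Z,\beta^\sharp\rangle\beta^\sharp\big)^\flat\otimes\beta^\sharp;$$ and if $\bar\nabla\beta=0$ (the Berwald case), then on $T\mathcal F$ $$c\,A^g=\bar A-\tfrac12\big(\bar A(\beta^\sharp)^{\bot\beta}+c\bar Z\big)\otimes\beta+\tfrac12c^{-2}\big(\bar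 A(\beta^\sharp)^{\bot\beta}-c\bar Z-c\langle\bar Z,\beta^\sharp\rangle\beta^\sharp\big)^\flat\otimes\beta^\sharp.$$ -/

import Mathlib

open Bundle
open scoped Manifold ContDiff

namespace RandersFoliation

noncomputable section

/-- The model space of a manifold of dimension `m + 1`. -/
abbrev Model (m : ℕ) : Type := EuclideanSpace ℝ (Fin (m + 1))

section LinearAlgebra

/-- The symmetric bilinear form
`g_y(u, v) = 1/2 ∂²/∂s∂t F²(y + s u + t v)` at `s = t = 0` of a Minkowski norm `F`. -/
def fundamentalForm {V : Type*} [AddCommGroup V] [Module ℝ V] (F : V → ℝ) (y u v : V) : ℝ :=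
  (1 / 2) * deriv (fun s : ℝ => deriv (fun t : ℝ => F (y + s • u + t • v) ^ 2) 0) 0

end LinearAlgebra

section Manifold

variable (m : ℕ) (M : Type*) [TopologicalSpace M] [ChartedSpace (Model m) M]

/-- Vector fields on `M` (no regularity is built in). -/
abbrev VField : Type _ := ∀ p : M, TangentSpace (𝓡 (m + 1)) p

/-- One-forms on `M` (no regularity is built in). -/
abbrev OneForm : Type _ := ∀ p : M, TangentSpace (𝓡 (m + 1)) p →L[ℝ] ℝ

/-- A codimension-one smooth foliation of `M`, recorded by the tangent spaces of its leaves: it is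
given near each point by the level sets of a smooth submersion to `ℝ`. -/
structure CodimOneFoliation where
  /-- the tangent space at `p` of the leaf through `p` -/
  tangent : ∀ p : M, Submodule ℝ (TangentSpace (𝓡 (m + 1)) p)
  locally_level_sets : ∀ p : M, ∃ (U : Set M) (f : M → ℝ), IsOpen U ∧ p ∈ U ∧
    ContMDiffOn (𝓡 (m + 1)) 𝓘(ℝ, ℝ) ∞ f U ∧
    ∀ q ∈ U, mvfderiv (𝓡 (m + 1)) f q ≠ 0 ∧
      ∀ v : TangentSpace (𝓡 (m + 1)) q, v ∈ tangent q ↔ mvfderiv (𝓡 (m + 1)) f q v = 0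

variable [IsManifold (𝓡 (m + 1)) ∞ M]

/-- Smooth Riemannian metrics on `M`. -/
abbrev Metric : Type _ :=
  ContMDiffRiemannianMetric (𝓡 (m + 1)) ∞ (Model m)
    (fun p : M => TangentSpace (𝓡 (m + 1)) p)

/-- Affine connections on `M`; `D Y p v` is `(D_v Y)(p)`. -/
abbrev Connection : Type _ :=
  CovariantDerivative (𝓡 (m + 1)) (Model m) (TangentSpace (𝓡 (m + 1)) : M → Type _)

variable {m M}

/-- The vector field `X` is smooth. -/
def SmoothField (X : VField m M) : Prop :=
  ContMDiff (𝓡 (m + 1)) ((𝓡 (m + 1)).prod 𝓘(ℝ, Model m)) ∞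
    (fun p => TotalSpace.mk' (Model m) p (X p))

/-- The one-form `β` is smooth. -/
def SmoothForm (β : OneForm m M) : Prop :=
  ContMDiff (𝓡 (m + 1)) ((𝓡 (m + 1)).prod 𝓘(ℝ, Model m →L[ℝ] ℝ)) ∞
    (fun p => TotalSpace.mk' (Model m →L[ℝ] ℝ)
      (E := fun p : M => TangentSpace (𝓡 (m + 1)) p →L[ℝ] ℝ) p (β p))

/-- `D` is the Levi-Civita connection of `g`: it is torsion free and
`v (g(Y, Z)) = g(D_v Y, Z) + g(Y, D_v Z)`. -/
def IsLeviCivita (g : ∀ p : M, TangentSpace (𝓡 (m + 1)) p → TangentSpace (𝓡 (m + 1)) p → ℝ)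
    (D : Connection m M) : Prop :=
  D.torsion = 0 ∧
    ∀ (Y Z : VField m M) (p : M),
      MDifferentiableAt (𝓡 (m + 1)) ((𝓡 (m + 1)).prod 𝓘(ℝ, Model m))
        (fun q => TotalSpace.mk' (Model m) q (Y q)) p →
      MDifferentiableAt (𝓡 (m + 1)) ((𝓡 (m + 1)).prod 𝓘(ℝ, Model m))
        (fun q => TotalSpace.mk' (Model m) q (Z q)) p →
      ∀ v : TangentSpace (𝓡 (m + 1)) p,
        mvfderiv (𝓡 (m + 1)) (fun q => g q (Y q) (Z q)) p v
          = g p (D Y p v) (Z p) + g p (Y p) (D Z p v)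

/-- `D β = 0`, where `(D_v β)(Y) = v (β(Y)) - β(D_v Y)`. -/
def IsParallelForm (D : Connection m M) (β : OneForm m M) : Prop :=
  ∀ (Y : VField m M) (p : M),
    MDifferentiableAt (𝓡 (m + 1)) ((𝓡 (m + 1)).prod 𝓘(ℝ, Model m))
      (fun q => TotalSpace.mk' (Model m) q (Y q)) p →
    ∀ v : TangentSpace (𝓡 (m + 1)) p,
      mvfderiv (𝓡 (m + 1)) (fun q => β q (Y q)) p v - β p (D Y p v) = 0

theorem exists_sharp (a : Metric m M) (p : M) (φ : TangentSpace (𝓡 (m + 1)) p →L[ℝ] ℝ) :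
    ∃ w : TangentSpace (𝓡 (m + 1)) p, ∀ u, a.inner p w u = φ u := by
  have : FiniteDimensional ℝ (TangentSpace (𝓡 (m + 1)) p) :=
    inferInstanceAs (FiniteDimensional ℝ (Model m))
  let L : TangentSpace (𝓡 (m + 1)) p →ₗ[ℝ] Module.Dual ℝ (TangentSpace (𝓡 (m + 1)) p) :=
    { toFun := fun w => (a.inner p w : TangentSpace (𝓡 (m + 1)) p →ₗ[ℝ] ℝ)
      map_add' := fun x y => by ext u; simp
      map_smul' := fun r x => by ext u; simp }
  have hinj : Function.Injective L := by
    rw [injective_iff_map_eq_zero]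
    intro w hw
    by_contra hne
    have h1 : a.inner p w w = 0 := by
      have := congrArg (fun f => f w) hw
      simpa [L] using this
    exact absurd h1 (a.pos p w hne).ne'
  have hsurj : Function.Surjective L :=
    (LinearMap.injective_iff_surjective_of_finrank_eq_finrank
      (Subspace.dual_finrank_eq (K := ℝ) (V := TangentSpace (𝓡 (m + 1)) p)).symm).1 hinj
  obtain ⟨w, hw⟩ := hsurj (φ : TangentSpace (𝓡 (m + 1)) p →ₗ[ℝ] ℝ)
  exact ⟨w, fun u => by simpa [L] using congrArg (fun f => f u) hw⟩

/-- The vector `φ♯` with `⟨φ♯, u⟩ = φ(u)` for all `u`. -/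
def sharp (a : Metric m M) (p : M) (φ : TangentSpace (𝓡 (m + 1)) p →L[ℝ] ℝ) :
    TangentSpace (𝓡 (m + 1)) p :=
  Classical.choose (exists_sharp a p φ)

theorem inner_sharp (a : Metric m M) (p : M) (φ : TangentSpace (𝓡 (m + 1)) p →L[ℝ] ℝ)
    (u : TangentSpace (𝓡 (m + 1)) p) : a.inner p (sharp a p φ) u = φ u :=
  Classical.choose_spec (exists_sharp a p φ) u

/-- The vector field `β♯`. -/
def sharpField (a : Metric m M) (β : OneForm m M) : VField m M := fun p => sharp a p (β p)

/-- The norm `‖β‖_α = ‖β♯‖_α` at `p`. -/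
def formNorm (a : Metric m M) (β : OneForm m M) (p : M) : ℝ :=
  Real.sqrt (a.inner p (sharpField a β p) (sharpField a β p))

/-- The function `c = (1 - ‖β‖_α²)^{1/2}`. -/
def cFun (a : Metric m M) (β : OneForm m M) (p : M) : ℝ :=
  Real.sqrt (1 - formNorm a β p ^ 2)

/-- The Randers norm `F(y) = √⟨y, y⟩ + β(y)` on `T_pM`. -/
def randersNorm (a : Metric m M) (β : OneForm m M) (p : M) (y : TangentSpace (𝓡 (m + 1)) p) : ℝ :=
  Real.sqrt (a.inner p y y) + β p y

/-- The bilinear form `g_{n(p)}` of the Randers norm on `T_pM`. -/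
def inducedMetric (a : Metric m M) (β : OneForm m M) (n : VField m M) (p : M)
    (u v : TangentSpace (𝓡 (m + 1)) p) : ℝ :=
  fundamentalForm (randersNorm a β p) (n p) u v

/-- `N` is a smooth unit normal field of the foliation for the metric `a`; such an `N` amounts to
a transversal orientation. -/
structure IsUnitNormal (a : Metric m M) (ℱ : CodimOneFoliation m M) (N : VField m M) : Prop where
  smooth : SmoothField N
  unit : ∀ p, a.inner p (N p) (N p) = 1
  normal : ∀ p, ∀ w ∈ ℱ.tangent p, a.inner p (N p) w = 0

/-- `n` is the `F`-normal field of the foliation with `⟨n, n⟩ = 1` which lies on the same side of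
the leaves as `N`. -/
structure IsFinslerNormal (a : Metric m M) (β : OneForm m M) (ℱ : CodimOneFoliation m M)
    (N n : VField m M) : Prop where
  unit : ∀ p, a.inner p (n p) (n p) = 1
  same_side : ∀ p, 0 < a.inner p (n p) (N p)
  normal : ∀ p, ∀ w ∈ ℱ.tangent p, fundamentalForm (randersNorm a β p) (n p) (n p) w = 0

/-- The `F`-unit normal `ν = n / F(n)`. -/
def finslerUnit (a : Metric m M) (β : OneForm m M) (n : VField m M) : VField m M :=
  fun p => (randersNorm a β p (n p))⁻¹ • n p

/-- The operator `u ↦ - D_u ξ`; it is the shape operator when `ξ` is a unit normal field and `D` the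
Levi-Civita connection of the metric. -/
def shape (D : Connection m M) (ξ : VField m M) (p : M) (u : TangentSpace (𝓡 (m + 1)) p) :
    TangentSpace (𝓡 (m + 1)) p :=
  - D ξ p u

/-- The component `X - ⟨X, N⟩ N` of `X` tangent to the leaf. -/
def tang (a : Metric m M) (N : VField m M) (p : M) (X : TangentSpace (𝓡 (m + 1)) p) :
    TangentSpace (𝓡 (m + 1)) p :=
  X - a.inner p X (N p) • N p

/-- The conjugate `(D ξ)^t` of the endomorphism `D ξ` with respect to `a`:
`⟨(D ξ)^t v, w⟩ = ⟨v, D_w ξ⟩`. -/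
def conjDeriv (a : Metric m M) (D : Connection m M) (ξ : VField m M) (p : M)
    (v : TangentSpace (𝓡 (m + 1)) p) : TangentSpace (𝓡 (m + 1)) p :=
  sharp a p ((a.inner p v).comp (D ξ p))

/-- The deformation tensor `Def_ξ = (D ξ + (D ξ)^t) / 2`. -/
def deform (a : Metric m M) (D : Connection m M) (ξ : VField m M) (p : M)
    (v : TangentSpace (𝓡 (m + 1)) p) : TangentSpace (𝓡 (m + 1)) p :=
  (1 / 2 : ℝ) • (D ξ p v + conjDeriv a D ξ p v)

/-- `X^{⊥β} = X - ⟨X, β♯⟩ ‖β♯‖⁻² β♯`; by the convention `0⁻¹ = 0` this is `X` where `β = 0`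
(it is only used for an `X` that vanishes there). -/
def perpForm (a : Metric m M) (β : OneForm m M) (p : M) (X : TangentSpace (𝓡 (m + 1)) p) :
    TangentSpace (𝓡 (m + 1)) p :=
  X - (a.inner p X (sharpField a β p) * (formNorm a β p ^ 2)⁻¹) • sharpField a β p

/-- The curvature vector `Z̄ = D_N N`. -/
def curvVec (D : Connection m M) (N : VField m M) (p : M) : TangentSpace (𝓡 (m + 1)) p :=
  D N p (N p)

/-- The derivative `(c N - β♯)(c)` of the function `c`. -/
def derivC (a : Metric m M) (β : OneForm m M) (N : VField m M) (p : M) : ℝ :=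
  mvfderiv (𝓡 (m + 1)) (cFun a β) p (cFun a β p • N p - sharpField a β p)

/-- The vector `(D_{N - c⁻¹ β♯} β♯)^⊤`. -/
def transDeriv (a : Metric m M) (D : Connection m M) (β : OneForm m M) (N : VField m M) (p : M) :
    TangentSpace (𝓡 (m + 1)) p :=
  tang a N p (D (sharpField a β) p (N p - (cFun a β p)⁻¹ • sharpField a β p))

/-- The vector field `U₁`, where `D` is the Levi-Civita connection of `a`. -/
def U₁ (a : Metric m M) (D : Connection m M) (β : OneForm m M) (N : VField m M) (p : M) :
    TangentSpace (𝓡 (m + 1)) p :=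
  (-(1 / 2 : ℝ) * (cFun a β p ^ 2)⁻¹) •
    (derivC a β N p • sharpField a β p
      - (2 * (cFun a β p)⁻¹) • tang a N p (deform a D (sharpField a β) p (sharpField a β p))
      - transDeriv a D β N p
      + cFun a β p • curvVec D N p
      + (cFun a β p * β p (curvVec D N p)) • sharpField a β p
      - perpForm a β p (shape D N p (sharpField a β p)))

/-- The vector field `U₂`, where `D` is the Levi-Civita connection of `a`. -/
def U₂ (a : Metric m M) (D : Connection m M) (β : OneForm m M) (N : VField m M) (p : M) :
    TangentSpace (𝓡 (m + 1)) p :=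
  (1 / 2 : ℝ) •
    (transDeriv a D β N p - cFun a β p • curvVec D N p
      - perpForm a β p (shape D N p (sharpField a β p)))

end Manifold

end

end RandersFoliation

open RandersFoliation

/-! The conditions on `n` force `n = c N - β♯`. On the leaves `g` is `c² (a - β ⊗ β)`, and `n` is
`g`-normal, so twice the second fundamental form of `n` is minus the Lie derivative of `g` along
`n`. As `n` has constant `a`-length, that derivative is expressed through `c` and `D n` alone.
Substituting `n = c N - β♯` and inverting `id - β♯ ⊗ β`, which is possible since `‖β‖_α < 1`,
gives the operator `A^g`. -/

namespace RandersFoliation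

section LieBracket

open VectorField Topology

variable {E H M : Type*} [NormedAddCommGroup E] [NormedSpace ℝ E] [TopologicalSpace H]
  {I : ModelWithCorners ℝ E H} [TopologicalSpace M] [ChartedSpace H M]

theorem mvfderiv_comp_apply_mpullback {E' H' M' : Type*} [NormedAddCommGroup E']
    [NormedSpace ℝ E'] [TopologicalSpace H'] {I' : ModelWithCorners ℝ E' H'} [TopologicalSpace M']
    [ChartedSpace H' M'] {g : M' → ℝ} {f : M → M'} {x : M}
    (hg : MDiffAt g (f x)) (hf : MDiffAt f x) (hf' : (mfderiv% f x).IsInvertible)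
    (V : ∀ y : M', TangentSpace I' y) :
    mvfderiv I (g ∘ f) x (mpullback I I' f V x) = mvfderiv I' g (f x) (V (f x)) := by
  rw [mvfderiv_comp_apply x hg hf, mpullback_apply, hf'.self_apply_inverse]

theorem mlieBracket_eq_lieBracket (V W : ∀ x : E, TangentSpace 𝓘(ℝ, E) x) :
    mlieBracket 𝓘(ℝ, E) V W = lieBracket ℝ V W := by
  rw [← mlieBracketWithin_univ]
  exact mlieBracketWithin_eq_lieBracketWithin.trans lieBracketWithin_univ

theorem isInvertible_mfderiv_extChartAt_symm [I.Boundaryless] [IsManifold I 1 M] {p : M} {y : E}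
    (hy : y ∈ (extChartAt I p).target) :
    (mfderiv 𝓘(ℝ, E) I (extChartAt I p).symm y).IsInvertible := by
  simpa only [I.range_eq_univ, mfderivWithin_univ] using
    isInvertible_mfderivWithin_extChartAt_symm (I := I) hy

theorem contMDiffAt_extChartAt_symm [I.Boundaryless] {k : ℕ∞ω} [IsManifold I k M] {p : M} {y : E}
    (hy : y ∈ (extChartAt I p).target) :
    ContMDiffAt 𝓘(ℝ, E) I k (extChartAt I p).symm y := by
  simpa only [I.range_eq_univ, contMDiffWithinAt_univ] using
    contMDiffWithinAt_extChartAt_symm_range (n := k) (I := I) p hy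

theorem differentiableAt_mpullback_extChartAt_symm [CompleteSpace E] [I.Boundaryless]
    [IsManifold I 2 M] {V : ∀ q : M, TangentSpace I q} {p : M} (hV : MDiffAt (T% V) p) :
    DifferentiableAt ℝ (mpullback 𝓘(ℝ, E) I (extChartAt I p).symm V) (extChartAt I p p) := by
  have h := (hV.mdifferentiableWithinAt (s := Set.univ)
    ).differentiableWithinAt_mpullbackWithin_vectorField
  rw [I.range_eq_univ, mpullbackWithin_univ] at h
  exact h.differentiableAt (by simp)

theorem mvfderiv_mlieBracket_eq_zero [CompleteSpace E] [I.Boundaryless] [IsManifold I 2 M]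
    {f : M → ℝ} {X Y : ∀ q : M, TangentSpace I q} {p : M} (hf : ContMDiffAt I 𝓘(ℝ, ℝ) 2 f p)
    (hX : MDiffAt (T% X) p) (hY : MDiffAt (T% Y) p)
    (hfX : ∀ᶠ q in 𝓝 p, mvfderiv I f q (X q) = 0) (hfY : ∀ᶠ q in 𝓝 p, mvfderiv I f q (Y q) = 0) :
    mvfderiv I f p (mlieBracket I X Y p) = 0 := by
  have : IsManifold I 1 M := .of_le one_le_two
  have : IsManifold I (minSmoothness ℝ 2) M := by simpa
  set φ := (extChartAt I p).symm
  set y := extChartAt I p p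
  have hy : y ∈ (extChartAt I p).target := mem_extChartAt_target p
  have hφy : φ y = p := extChartAt_to_inv p
  have hφ : ContMDiffAt 𝓘(ℝ, E) I 2 φ y := contMDiffAt_extChartAt_symm hy
  have hφ' := isInvertible_mfderiv_extChartAt_symm hy
  rw [← hφy] at hf hfX hfY ⊢
  have eventually_pullback : ∀ {V : ∀ q : M, TangentSpace I q},
      (∀ᶠ q in 𝓝 (φ y), mvfderiv I f q (V q) = 0) →
        (fun z => fderiv ℝ (f ∘ φ) z (mpullback 𝓘(ℝ, E) I φ V z)) =ᶠ[𝓝 y] fun _ => 0 := by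
    intro V hV
    filter_upwards [hφ.continuousAt.eventually hV,
      hφ.continuousAt.eventually ((contMDiffAt_iff_contMDiffAt_nhds (by simp)).1 hf),
      extChartAt_target_mem_nhds p] with z hVz hfz hz
    rw [← mfderiv_eq_fderiv]
    exact (mvfderiv_comp_apply_mpullback (hfz.mdifferentiableAt two_ne_zero)
      ((contMDiffAt_extChartAt_symm hz).mdifferentiableAt one_ne_zero)
      (isInvertible_mfderiv_extChartAt_symm hz) V).trans hVz
  rw [← mvfderiv_comp_apply_mpullback (hf.mdifferentiableAt two_ne_zero)
    (hφ.mdifferentiableAt two_ne_zero) hφ',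
    mpullback_mlieBracket (by rwa [hφy]) (by rwa [hφy]) hφ (by simp),
    mlieBracket_eq_lieBracket, mvfderiv, mfderiv_eq_fderiv]
  refine (fderiv_apply_lieBracket (hf.comp y hφ).contDiffAt (by simp)
    (differentiableAt_mpullback_extChartAt_symm hY)
    (differentiableAt_mpullback_extChartAt_symm hX)).trans ?_
  rw [(eventually_pullback hfX).fderiv_eq, (eventually_pullback hfY).fderiv_eq, fderiv_fun_const]
  exact sub_zero _

end LieBracket

section InvertibleBundleMap

open ContinuousLinearMap

variable {EB HB B F₁ F₂ : Type*} [NormedAddCommGroup EB] [NormedSpace ℝ EB] [TopologicalSpace HB]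
  {IB : ModelWithCorners ℝ EB HB} [TopologicalSpace B] [ChartedSpace HB B]
  [NormedAddCommGroup F₁] [NormedSpace ℝ F₁] [NormedAddCommGroup F₂] [NormedSpace ℝ F₂]
  {E₁ E₂ : B → Type*} [TopologicalSpace (TotalSpace F₁ E₁)] [∀ q, AddCommGroup (E₁ q)]
  [∀ q, Module ℝ (E₁ q)] [∀ q, TopologicalSpace (E₁ q)] [FiberBundle F₁ E₁] [VectorBundle ℝ F₁ E₁]
  [TopologicalSpace (TotalSpace F₂ E₂)] [∀ q, AddCommGroup (E₂ q)] [∀ q, Module ℝ (E₂ q)]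
  [∀ q, TopologicalSpace (E₂ q)] [FiberBundle F₂ E₂] [VectorBundle ℝ F₂ E₂]
  {A : ∀ q, E₁ q →L[ℝ] E₂ q} {p : B}

theorem eventually_inCoordinates_inverse :
    ∀ᶠ q in nhds p, inCoordinates F₂ E₂ F₁ E₁ p q p q (A q).inverse =
      (inCoordinates F₁ E₁ F₂ E₂ p q p q (A q)).inverse := by
  filter_upwards [
    (trivializationAt F₁ E₁ p).open_baseSet.mem_nhds (FiberBundle.mem_baseSet_trivializationAt' p),
    (trivializationAt F₂ E₂ p).open_baseSet.mem_nhds (FiberBundle.mem_baseSet_trivializationAt' p)]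
    with q hq₁ hq₂
  rw [inCoordinates_eq hq₁ hq₂, inCoordinates_eq hq₂ hq₁]
  simp only [inverse_equiv_comp, inverse_comp_equiv, ContinuousLinearEquiv.symm_symm]
  rfl

theorem isInvertible_inCoordinates (hA : (A p).IsInvertible) :
    (inCoordinates F₁ E₁ F₂ E₂ p p p p (A p)).IsInvertible := by
  rw [inCoordinates_eq (FiberBundle.mem_baseSet_trivializationAt' p)
    (FiberBundle.mem_baseSet_trivializationAt' p)]
  exact isInvertible_equiv.comp (hA.comp isInvertible_equiv)

variable [CompleteSpace F₁] [∀ q, IsTopologicalAddGroup (E₂ q)] [∀ q, ContinuousSMul ℝ (E₂ q)]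

theorem mdifferentiableAt_section_of_isInvertible {s : ∀ q, E₁ q} (hA : ∀ q, (A q).IsInvertible)
    (hAd : MDifferentiableAt IB (IB.prod 𝓘(ℝ, F₁ →L[ℝ] F₂))
      (fun q => TotalSpace.mk' (F₁ →L[ℝ] F₂) (E := fun q => E₁ q →L[ℝ] E₂ q) q (A q)) p)
    (hs : MDifferentiableAt IB (IB.prod 𝓘(ℝ, F₂)) (fun q => TotalSpace.mk' F₂ q (A q (s q))) p) :
    MDifferentiableAt IB (IB.prod 𝓘(ℝ, F₁)) (fun q => TotalSpace.mk' F₁ q (s q)) p := by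
  have hA_coord : MDifferentiableAt IB 𝓘(ℝ, F₁ →L[ℝ] F₂)
      (fun q => inCoordinates F₁ E₁ F₂ E₂ p q p q (A q)) p :=
    ((mdifferentiableAt_hom_bundle _).1 hAd).2
  have h_inverse : MDifferentiableAt 𝓘(ℝ, F₁ →L[ℝ] F₂) 𝓘(ℝ, F₂ →L[ℝ] F₁) inverse
      (inCoordinates F₁ E₁ F₂ E₂ p p p p (A p)) :=
    ((isInvertible_inCoordinates (hA p)).contDiffAt_map_inverse (n := 1)).contMDiffAt
      |>.mdifferentiableAt one_ne_zero
  have hinv_coord : MDifferentiableAt IB 𝓘(ℝ, F₂ →L[ℝ] F₁)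
      (fun q => inCoordinates F₂ E₂ F₁ E₁ p q p q (A q).inverse) p :=
    (MDifferentiableAt.comp (g := inverse) p h_inverse hA_coord).congr_of_eventuallyEq
      eventually_inCoordinates_inverse
  simpa only [(hA _).inverse_apply_self, id] using
    MDifferentiableAt.clm_apply_of_inCoordinates (b₁ := id) (b₂ := id)
      (ϕ := fun q => (A q).inverse) (v := fun q => A q (s q)) hinv_coord hs mdifferentiableAt_id

end InvertibleBundleMap

theorem isInvertible_of_injective_of_finrank_eq {E F : Type*}
    [NormedAddCommGroup E] [NormedSpace ℝ E] [FiniteDimensional ℝ E]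
    [NormedAddCommGroup F] [NormedSpace ℝ F] [FiniteDimensional ℝ F]
    {L : E →L[ℝ] F} (hL : Function.Injective L)
    (h : Module.finrank ℝ E = Module.finrank ℝ F) : L.IsInvertible :=
  ⟨(LinearEquiv.ofInjectiveOfFinrankEq (L : E →ₗ[ℝ] F) hL h).toContinuousLinearEquiv, rfl⟩

section RandersAlgebra

variable {V : Type*} [AddCommGroup V] [Module ℝ V]

theorem hasDerivAt_linear_comp_line (ψ : V →ₗ[ℝ] ℝ) (z w : V) :
    HasDerivAt (fun t : ℝ => ψ (z + t • w)) (ψ w) 0 := by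
  simpa using ((hasDerivAt_id (0 : ℝ)).mul_const (ψ w)).const_add (ψ z)

variable {B : V →ₗ[ℝ] V →ₗ[ℝ] ℝ}

theorem hasDerivAt_sqrt_comp_line (hB : ∀ u v, B u v = B v u) {z : V} (hz : 0 < B z z) (w : V) :
    HasDerivAt (fun t : ℝ => Real.sqrt (B (z + t • w) (z + t • w)))
      (B z w / Real.sqrt (B z z)) 0 := by
  have hquad : HasDerivAt (fun t : ℝ => B (z + t • w) (z + t • w)) (2 * B z w) 0 := by
    have hpoly : (fun t : ℝ => B (z + t • w) (z + t • w)) =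
        fun t => B z z + 2 * B z w * t + B w w * t ^ 2 := by
      ext t
      simp only [map_add, map_smul, LinearMap.add_apply, LinearMap.smul_apply, smul_eq_mul, hB w z]
      ring
    rw [hpoly]
    simpa using (((hasDerivAt_id (0 : ℝ)).const_mul (2 * B z w)).const_add (B z z)).fun_add
      (((hasDerivAt_id (0 : ℝ)).fun_pow 2).const_mul (B w w))
  refine (hquad.sqrt (by simpa using hz.ne')).congr_deriv ?_
  rw [zero_smul, add_zero, mul_div_mul_left _ _ two_ne_zero]

theorem hasDerivAt_randers_comp_line (hB : ∀ u v, B u v = B v u) (φ : V →ₗ[ℝ] ℝ) {z : V}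
    (hz : 0 < B z z) (w : V) :
    HasDerivAt (fun t : ℝ => Real.sqrt (B (z + t • w) (z + t • w)) + φ (z + t • w))
      (B z w / Real.sqrt (B z z) + φ w) 0 :=
  (hasDerivAt_sqrt_comp_line hB hz w).add (hasDerivAt_linear_comp_line φ z w)

theorem fundamentalForm_randers (hB : ∀ u v, B u v = B v u) (φ : V →ₗ[ℝ] ℝ) {y : V}
    (hy : 0 < B y y) (u v : V) :
    fundamentalForm (fun z => Real.sqrt (B z z) + φ z) y u v =
      (Real.sqrt (B y y) + φ y) *
          (B u v / Real.sqrt (B y y) - B y u * B y v / Real.sqrt (B y y) ^ 3) +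
        (B y u / Real.sqrt (B y y) + φ u) * (B y v / Real.sqrt (B y y) + φ v) := by
  have hpos : ∀ᶠ s : ℝ in nhds 0, 0 < B (y + s • u) (y + s • u) := by
    have hcont : Continuous fun s : ℝ => B (y + s • u) (y + s • u) := by
      simp only [map_add, map_smul, LinearMap.add_apply, LinearMap.smul_apply, smul_eq_mul]
      fun_prop
    exact hcont.continuousAt.eventually (lt_mem_nhds (by simpa using hy))
  have hinner : (fun s : ℝ => deriv (fun t : ℝ =>
      (Real.sqrt (B (y + s • u + t • v) (y + s • u + t • v)) + φ (y + s • u + t • v)) ^ 2) 0)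
      =ᶠ[nhds 0] fun s => 2 * (Real.sqrt (B (y + s • u) (y + s • u)) + φ (y + s • u)) *
        (B (y + s • u) v / Real.sqrt (B (y + s • u) (y + s • u)) + φ v) := by
    filter_upwards [hpos] with s hs
    simpa only [zero_smul, add_zero, Nat.cast_ofNat, Nat.add_one_sub_one, pow_one] using
      ((hasDerivAt_randers_comp_line hB φ hs v).fun_pow 2).deriv
  have houter := ((hasDerivAt_randers_comp_line hB φ hy u).const_mul 2).fun_mul
    (((hasDerivAt_linear_comp_line (B.flip v) y u).fun_div (hasDerivAt_sqrt_comp_line hB hy u)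
      (by simpa using (Real.sqrt_pos.2 hy).ne')).add_const (φ v))
  have hsqrt : Real.sqrt (B y y) ≠ 0 := (Real.sqrt_pos.2 hy).ne'
  rw [fundamentalForm, hinner.deriv_eq]
  refine (congrArg (1 / 2 * ·) houter.deriv).trans ?_
  simp only [zero_smul, add_zero, LinearMap.flip_apply]
  field_simp
  ring

end RandersAlgebra

variable {m : ℕ} {M : Type*} [TopologicalSpace M] [ChartedSpace (Model m) M]
  [IsManifold (𝓡 (m + 1)) ∞ M] {a : Metric m M} {β : OneForm m M} {ℱ : CodimOneFoliation m M}
  {N n : VField m M} {p : M}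

section Metric

theorem inner_self_nonneg (a : Metric m M) (p : M) (u : TangentSpace (𝓡 (m + 1)) p) :
    0 ≤ a.inner p u u := by
  by_cases h : u = 0
  · simp [h]
  · exact (a.pos p u h).le

theorem eq_zero_of_inner_self_eq_zero {u : TangentSpace (𝓡 (m + 1)) p} (h : a.inner p u u = 0) :
    u = 0 :=
  by_contra fun hu => (a.pos p u hu).ne' h

theorem inner_ext {x y : TangentSpace (𝓡 (m + 1)) p} (h : ∀ w, a.inner p x w = a.inner p y w) :
    x = y :=
  sub_eq_zero.1 (eq_zero_of_inner_self_eq_zero (a := a) (by simp [h]))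

theorem isInvertible_inner (a : Metric m M) (p : M) : (a.inner p).IsInvertible := by
  have hinj : Function.Injective (a.inner p) := fun x y h => inner_ext fun w => by rw [h]
  have hfinrank : Module.finrank ℝ (Model m) = Module.finrank ℝ (Model m →L[ℝ] ℝ) := by
    rw [← (LinearMap.toContinuousLinearMap (𝕜 := ℝ) (E := Model m) (F' := ℝ)).finrank_eq]
    exact (Subspace.dual_finrank_eq (K := ℝ) (V := Model m)).symm
  exact isInvertible_of_injective_of_finrank_eq (E := Model m) (F := Model m →L[ℝ] ℝ) hinj hfinrank

@[simp]
theorem inner_sharpField (a : Metric m M) (β : OneForm m M) (p : M)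
    (u : TangentSpace (𝓡 (m + 1)) p) : a.inner p (sharpField a β p) u = β p u :=
  inner_sharp a p (β p) u

@[simp]
theorem inner_sharpField_right (a : Metric m M) (β : OneForm m M) (p : M)
    (u : TangentSpace (𝓡 (m + 1)) p) : a.inner p u (sharpField a β p) = β p u := by
  rw [a.symm, inner_sharpField]

theorem formNorm_sq (a : Metric m M) (β : OneForm m M) (p : M) :
    formNorm a β p ^ 2 = β p (sharpField a β p) := by
  rw [formNorm, Real.sq_sqrt (inner_self_nonneg a p _), inner_sharpField]

theorem one_sub_formNorm_sq_pos (h : formNorm a β p < 1) : 0 < 1 - formNorm a β p ^ 2 :=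
  sub_pos.2 (pow_lt_one₀ (Real.sqrt_nonneg _) h two_ne_zero)

theorem cFun_pos (h : formNorm a β p < 1) : 0 < cFun a β p :=
  Real.sqrt_pos.2 (one_sub_formNorm_sq_pos h)

theorem cFun_sq (h : formNorm a β p < 1) : cFun a β p ^ 2 = 1 - β p (sharpField a β p) := by
  rw [← formNorm_sq, cFun, Real.sq_sqrt (one_sub_formNorm_sq_pos h).le]

theorem one_add_form_pos {y : TangentSpace (𝓡 (m + 1)) p} (h : formNorm a β p < 1)
    (hy : a.inner p y y = 1) : 0 < 1 + β p y := by
  have hsq := one_sub_formNorm_sq_pos h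
  have hadd := inner_self_nonneg a p (y + sharpField a β p)
  simp only [map_add, add_apply, hy, inner_sharpField, inner_sharpField_right] at hadd
  rw [formNorm_sq] at hsq
  linarith

theorem form_perpForm (a : Metric m M) (β : OneForm m M) (p : M) (X : TangentSpace (𝓡 (m + 1)) p) :
    β p (perpForm a β p X) = 0 := by
  rw [perpForm, formNorm_sq, inner_sharpField_right, map_sub, map_smul, smul_eq_mul]
  by_cases h : β p (sharpField a β p) = 0
  · have hsharp : sharpField a β p = 0 :=
      eq_zero_of_inner_self_eq_zero (a := a) (by rw [inner_sharpField, h])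
    rw [h, ← inner_sharpField a β p X, hsharp]
    simp
  · field_simp
    ring

theorem exists_perpForm_eq (hβ1 : formNorm a β p < 1) (X : TangentSpace (𝓡 (m + 1)) p) :
    ∃ k : ℝ, perpForm a β p X = X - k • sharpField a β p ∧ β p X = k * (1 - cFun a β p ^ 2) := by
  refine ⟨_, rfl, ?_⟩
  have h := form_perpForm a β p X
  rw [perpForm, map_sub, map_smul, smul_eq_mul, sub_eq_zero] at h
  rw [h, cFun_sq hβ1, sub_sub_cancel]

theorem inner_tang {v : TangentSpace (𝓡 (m + 1)) p} (hv : a.inner p (N p) v = 0)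
    (X : TangentSpace (𝓡 (m + 1)) p) : a.inner p (tang a N p X) v = a.inner p X v := by
  simp [tang, hv]

theorem inner_normal_tang (hN : a.inner p (N p) (N p) = 1) (X : TangentSpace (𝓡 (m + 1)) p) :
    a.inner p (N p) (tang a N p X) = 0 := by
  simp [tang, hN, a.symm p X]

theorem form_tang (hβN : β p (N p) = 0) (X : TangentSpace (𝓡 (m + 1)) p) :
    β p (tang a N p X) = β p X := by
  simp [tang, hβN]

theorem two_mul_inner_deform (D : Connection m M) (ξ : VField m M)
    (u v : TangentSpace (𝓡 (m + 1)) p) :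
    2 * a.inner p (deform a D ξ p u) v = a.inner p (D ξ p u) v + a.inner p u (D ξ p v) := by
  simp only [deform, conjDeriv, map_smul, map_add, smul_apply, add_apply, inner_sharp, smul_eq_mul,
    ContinuousLinearMap.comp_apply]
  ring

theorem inner_deform_symm (D : Connection m M) (ξ : VField m M)
    (u v : TangentSpace (𝓡 (m + 1)) p) :
    a.inner p (deform a D ξ p u) v = a.inner p (deform a D ξ p v) u := by
  have huv := two_mul_inner_deform (a := a) D ξ u v
  have hvu := two_mul_inner_deform (a := a) D ξ v u
  rw [a.symm p u] at huv
  rw [a.symm p v] at hvu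
  linarith

end Metric

section Differentiability

/-- The vector field `X` is differentiable at `p`, as a section of the tangent bundle. -/
abbrev DifferentiableFieldAt (X : VField m M) (p : M) : Prop :=
  MDifferentiableAt (𝓡 (m + 1)) ((𝓡 (m + 1)).prod 𝓘(ℝ, Model m))
    (fun q => TotalSpace.mk' (Model m) q (X q)) p

theorem mdifferentiableAt_inner (a : Metric m M) {X Y : VField m M}
    (hX : DifferentiableFieldAt X p) (hY : DifferentiableFieldAt Y p) :
    MDifferentiableAt (𝓡 (m + 1)) 𝓘(ℝ, ℝ) (fun q => a.inner q (X q) (Y q)) p := by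
  have h := MDifferentiableAt.clm_bundle_apply₂ (F₁ := Model m) (F₂ := Model m) (F₃ := ℝ)
    (E₃ := fun _ : M => ℝ) ((a.contMDiff p).mdifferentiableAt (by simp)) hX hY
  simp only [mdifferentiableAt_totalSpace] at h
  exact h.2

theorem differentiableFieldAt_sharpField (a : Metric m M) {β : OneForm m M}
    (hβ : MDifferentiableAt (𝓡 (m + 1)) ((𝓡 (m + 1)).prod 𝓘(ℝ, Model m →L[ℝ] ℝ))
      (fun q => TotalSpace.mk' (Model m →L[ℝ] ℝ)
        (E := fun q : M => TangentSpace (𝓡 (m + 1)) q →L[ℝ] ℝ) q (β q)) p) :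
    DifferentiableFieldAt (sharpField a β) p := by
  have hsharp : ∀ q, a.inner q (sharpField a β q) = β q := fun q => by
    ext u
    exact inner_sharpField a β q u
  refine mdifferentiableAt_section_of_isInvertible (isInvertible_inner a)
    ((a.contMDiff p).mdifferentiableAt (by simp)) ?_
  simpa only [hsharp] using hβ

theorem mdifferentiableAt_cFun (hβ1 : formNorm a β p < 1)
    (hb : DifferentiableFieldAt (sharpField a β) p) :
    MDifferentiableAt (𝓡 (m + 1)) 𝓘(ℝ, ℝ) (cFun a β) p := by
  have hsqrt : DifferentiableAt ℝ Real.sqrt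
      (1 - a.inner p (sharpField a β p) (sharpField a β p)) := by
    rw [inner_sharpField, ← formNorm_sq]
    exact (Real.hasDerivAt_sqrt (one_sub_formNorm_sq_pos hβ1).ne').differentiableAt
  refine (MDifferentiableAt.comp p hsqrt.mdifferentiableAt
    ((mdifferentiableAt_const (c := (1 : ℝ))).sub (mdifferentiableAt_inner a hb hb))
    ).congr_of_eventuallyEq (.of_forall fun q => ?_)
  simp only [cFun, formNorm_sq, Function.comp_apply, Pi.sub_apply, inner_sharpField]

theorem mdifferentiableAt_inv_cFun_sq (hβ1 : formNorm a β p < 1)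
    (hb : DifferentiableFieldAt (sharpField a β) p) :
    MDifferentiableAt (𝓡 (m + 1)) 𝓘(ℝ, ℝ) (fun q => (cFun a β q ^ 2)⁻¹) p := by
  have hinv : DifferentiableAt ℝ (fun x : ℝ => (x ^ 2)⁻¹) (cFun a β p) :=
    (differentiableAt_id.pow 2).inv (pow_ne_zero 2 (cFun_pos hβ1).ne')
  exact MDifferentiableAt.comp (g := fun x : ℝ => (x ^ 2)⁻¹) p hinv.mdifferentiableAt
    (mdifferentiableAt_cFun hβ1 hb)

end Differentiability

section Connection

theorem Connection.sub (D : Connection m M) {X Y : VField m M} (hX : DifferentiableFieldAt X p)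
    (hY : DifferentiableFieldAt Y p) : D (X - Y) p = D X p - D Y p := by
  have hD := D.isCovariantDerivativeOnUniv
  have hnegY : DifferentiableFieldAt ((-1 : ℝ) • Y) p := by
    rw [neg_one_smul]
    exact mdifferentiableAt_neg_section hY
  have hadd := hD.add hX hnegY
  rw [hD.smul_const (-1) hY] at hadd
  simpa [sub_eq_add_neg] using hadd

variable {g : ∀ p : M, TangentSpace (𝓡 (m + 1)) p → TangentSpace (𝓡 (m + 1)) p → ℝ}
  {D : Connection m M} {X Y ξ : VField m M}

theorem IsLeviCivita.torsion_free (hD : IsLeviCivita g D) (hX : DifferentiableFieldAt X p)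
    (hY : DifferentiableFieldAt Y p) :
    D Y p (X p) - D X p (Y p) = VectorField.mlieBracket (𝓡 (m + 1)) X Y p :=
  (CovariantDerivative.torsion_eq_zero_iff D).1 hD.1 hX hY

theorem IsLeviCivita.deriv_add_eq_zero_of_const (hD : IsLeviCivita g D)
    (hX : DifferentiableFieldAt X p) (hY : DifferentiableFieldAt Y p) {k : ℝ}
    (h : ∀ q, g q (X q) (Y q) = k) (w : TangentSpace (𝓡 (m + 1)) p) :
    g p (D X p w) (Y p) + g p (X p) (D Y p w) = 0 := by
  rw [← hD.2 X Y p hX hY w, funext h, mvfderiv_const, zero_apply]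

-- The right-hand side is the Lie derivative `(L_ξ g)(X, Y)`.
theorem IsLeviCivita.two_mul_deriv_normal (hD : IsLeviCivita g D)
    (hsymm : ∀ u v, g p u v = g p v u) (hsub : ∀ u v w, g p (u - v) w = g p u w - g p v w)
    (hξ : DifferentiableFieldAt ξ p) (hX : DifferentiableFieldAt X p)
    (hY : DifferentiableFieldAt Y p) (hξX : ∀ q, g q (ξ q) (X q) = 0)
    (hξY : ∀ q, g q (ξ q) (Y q) = 0)
    (hXY : g p (ξ p) (VectorField.mlieBracket (𝓡 (m + 1)) X Y p) = 0) :
    2 * g p (D ξ p (X p)) (Y p) =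
      mvfderiv (𝓡 (m + 1)) (fun q => g q (X q) (Y q)) p (ξ p)
        - g p (VectorField.mlieBracket (𝓡 (m + 1)) ξ X p) (Y p)
        - g p (VectorField.mlieBracket (𝓡 (m + 1)) ξ Y p) (X p) := by
  have hderivX := hD.deriv_add_eq_zero_of_const hξ hY hξY (X p)
  have hderivY := hD.deriv_add_eq_zero_of_const hξ hX hξX (Y p)
  rw [← hD.torsion_free hX hY, hsymm, hsub, hsymm _ (ξ p), hsymm _ (ξ p)] at hXY
  rw [hD.2 X Y p hX hY, ← hD.torsion_free hξ hX, ← hD.torsion_free hξ hY, hsub, hsub,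
    hsymm (X p)]
  linear_combination hderivX - hderivY - hXY

end Connection

section UnitNormal

variable {D : Connection m M} {X Y : VField m M} {u v : TangentSpace (𝓡 (m + 1)) p}

theorem IsUnitNormal.differentiableFieldAt (hN : IsUnitNormal a ℱ N) (p : M) :
    DifferentiableFieldAt N p :=
  (hN.smooth p).mdifferentiableAt (by simp)

theorem IsUnitNormal.exists_defining_function (hN : IsUnitNormal a ℱ N) (p : M) :
    ∃ (U : Set M) (f : M → ℝ), U ∈ nhds p ∧ ContMDiffAt (𝓡 (m + 1)) 𝓘(ℝ, ℝ) ∞ f p ∧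
      ∀ q ∈ U, mvfderiv (𝓡 (m + 1)) f q (N q) ≠ 0 ∧
        (∀ v, v ∈ ℱ.tangent q ↔ mvfderiv (𝓡 (m + 1)) f q v = 0) ∧
        ∀ v, mvfderiv (𝓡 (m + 1)) f q v =
          mvfderiv (𝓡 (m + 1)) f q (N q) * a.inner q (N q) v := by
  obtain ⟨U, f, hU, hp, hf, htangent⟩ := ℱ.locally_level_sets p
  refine ⟨U, f, hU.mem_nhds hp, (hf p hp).contMDiffAt (hU.mem_nhds hp), fun q hq => ?_⟩
  have hne : mvfderiv (𝓡 (m + 1)) f q (N q) ≠ 0 := fun hzero => by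
    have hnormal := hN.normal q (N q) (((htangent q hq).2 _).2 hzero)
    exact one_ne_zero ((hN.unit q).symm.trans hnormal)
  refine ⟨hne, (htangent q hq).2, fun v => ?_⟩
  have hmem : v - (mvfderiv (𝓡 (m + 1)) f q v / mvfderiv (𝓡 (m + 1)) f q (N q)) • N q ∈
      ℱ.tangent q := by
    rw [(htangent q hq).2, map_sub, map_smul, smul_eq_mul, div_mul_cancel₀ _ hne, sub_self]
  have hnormal := hN.normal q _ hmem
  rw [map_sub, map_smul, smul_eq_mul, hN.unit q, mul_one, sub_eq_zero] at hnormal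
  rw [hnormal, mul_div_cancel₀ _ hne]

theorem IsUnitNormal.mem_tangent_iff (hN : IsUnitNormal a ℱ N) :
    v ∈ ℱ.tangent p ↔ a.inner p (N p) v = 0 := by
  obtain ⟨U, f, hU, -, h⟩ := hN.exists_defining_function p
  obtain ⟨hne, hmem, hinner⟩ := h p (mem_of_mem_nhds hU)
  rw [hmem, hinner, mul_eq_zero, or_iff_right hne]

theorem IsUnitNormal.tang_mem (hN : IsUnitNormal a ℱ N) (w : TangentSpace (𝓡 (m + 1)) p) :
    tang a N p w ∈ ℱ.tangent p :=
  hN.mem_tangent_iff.2 (inner_normal_tang (hN.unit p) w)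

theorem IsUnitNormal.inner_mlieBracket (hN : IsUnitNormal a ℱ N)
    (hX : DifferentiableFieldAt X p) (hY : DifferentiableFieldAt Y p)
    (hNX : ∀ q, a.inner q (N q) (X q) = 0) (hNY : ∀ q, a.inner q (N q) (Y q) = 0) :
    a.inner p (N p) (VectorField.mlieBracket (𝓡 (m + 1)) X Y p) = 0 := by
  obtain ⟨U, f, hU, hf, h⟩ := hN.exists_defining_function p
  have hU' : ∀ᶠ q in nhds p, q ∈ U := hU
  have : IsManifold (𝓡 (m + 1)) 2 M := IsManifold.of_le (n := ∞) ENat.LEInfty.out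
  have hbracket := mvfderiv_mlieBracket_eq_zero (hf.of_le ENat.LEInfty.out) hX hY
    (hU'.mono fun q hq => by rw [(h q hq).2.2, hNX, mul_zero])
    (hU'.mono fun q hq => by rw [(h q hq).2.2, hNY, mul_zero])
  obtain ⟨hne, -, hinner⟩ := h p (mem_of_mem_nhds hU)
  rw [hinner] at hbracket
  exact (mul_eq_zero.1 hbracket).resolve_left hne

theorem IsUnitNormal.exists_tangent_extension (hN : IsUnitNormal a ℱ N) (hu : u ∈ ℱ.tangent p) :
    ∃ X : VField m M, DifferentiableFieldAt X p ∧ X p = u ∧ ∀ q, a.inner q (N q) (X q) = 0 := by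
  have hextend : DifferentiableFieldAt (FiberBundle.extend (Model m) u) p :=
    FiberBundle.mdifferentiableAt_extend (𝓡 (m + 1)) (Model m) u
  have hNp := hN.differentiableFieldAt p
  refine ⟨FiberBundle.extend (Model m) u -
    (fun q => a.inner q (N q) (FiberBundle.extend (Model m) u q)) • N, ?_, ?_, fun q => ?_⟩
  · exact mdifferentiableAt_sub_section hextend
      ((mdifferentiableAt_inner a hNp hextend).smul_section hNp)
  · simp [hN.normal p u hu]
  · simp [hN.unit q]

theorem IsUnitNormal.inner_deriv_self (hN : IsUnitNormal a ℱ N)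
    (hD : IsLeviCivita (fun p u v => a.inner p u v) D) (w : TangentSpace (𝓡 (m + 1)) p) :
    a.inner p (N p) (D N p w) = 0 := by
  have hNp := hN.differentiableFieldAt p
  have h := hD.deriv_add_eq_zero_of_const hNp hNp hN.unit w
  rw [a.symm p (D N p w)] at h
  linarith

theorem IsUnitNormal.inner_deriv_symm (hN : IsUnitNormal a ℱ N)
    (hD : IsLeviCivita (fun p u v => a.inner p u v) D) (hu : u ∈ ℱ.tangent p)
    (hv : v ∈ ℱ.tangent p) : a.inner p (D N p u) v = a.inner p (D N p v) u := by
  obtain ⟨X, hX, rfl, hNX⟩ := hN.exists_tangent_extension hu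
  obtain ⟨Y, hY, rfl, hNY⟩ := hN.exists_tangent_extension hv
  have hNp := hN.differentiableFieldAt p
  have hderivY := hD.deriv_add_eq_zero_of_const hNp hY hNY (X p)
  have hderivX := hD.deriv_add_eq_zero_of_const hNp hX hNX (Y p)
  have hbracket := hN.inner_mlieBracket hX hY hNX hNY
  rw [← hD.torsion_free hX hY, map_sub] at hbracket
  linear_combination hderivY - hderivX - hbracket

end UnitNormal

section FinslerNormal

theorem fundamentalForm_randersNorm {y : TangentSpace (𝓡 (m + 1)) p} (hy : a.inner p y y = 1)
    (u v : TangentSpace (𝓡 (m + 1)) p) :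
    fundamentalForm (randersNorm a β p) y u v =
      (1 + β p y) * (a.inner p u v - a.inner p y u * a.inner p y v)
        + (a.inner p y u + β p u) * (a.inner p y v + β p v) := by
  have h : fundamentalForm (randersNorm a β p) y u v = _ := fundamentalForm_randers
    (B := LinearMap.mk₂ ℝ (fun u v => a.inner p u v) (by simp) (by simp) (by simp) (by simp))
    (fun u v => a.symm p u v) (β p : TangentSpace (𝓡 (m + 1)) p →ₗ[ℝ] ℝ) (by simp [hy]) u v
  simpa [hy] using h

theorem IsFinslerNormal.inner_add_form_of_mem (hn : IsFinslerNormal a β ℱ N n)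
    (hβ1 : formNorm a β p < 1) {w : TangentSpace (𝓡 (m + 1)) p} (hw : w ∈ ℱ.tangent p) :
    a.inner p (n p) w + β p w = 0 := by
  have h := hn.normal p w hw
  rw [fundamentalForm_randersNorm (hn.unit p), hn.unit p, one_mul, sub_self, mul_zero,
    zero_add] at h
  exact (mul_eq_zero.1 h).resolve_left (one_add_form_pos hβ1 (hn.unit p)).ne'

variable (hN : IsUnitNormal a ℱ N) (hn : IsFinslerNormal a β ℱ N n) (hβ1 : ∀ p, formNorm a β p < 1)
  (hβN : ∀ p, β p (N p) = 0)

include hN hn hβ1 hβN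

theorem IsFinslerNormal.inner_add_form (w : TangentSpace (𝓡 (m + 1)) p) :
    a.inner p (n p) w + β p w = a.inner p (n p) (N p) * a.inner p (N p) w := by
  have h := hn.inner_add_form_of_mem (hβ1 p) (hN.tang_mem w)
  simp only [tang, map_sub, map_smul, smul_eq_mul, hβN, a.symm p w] at h
  linear_combination h

theorem IsFinslerNormal.inner_normal : a.inner p (n p) (N p) = cFun a β p := by
  have hself := hn.inner_add_form hN hβ1 hβN (n p)
  have hsharp := hn.inner_add_form hN hβ1 hβN (sharpField a β p)
  rw [hn.unit, a.symm p (N p)] at hself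
  rw [inner_sharpField_right, inner_sharpField_right, hβN, mul_zero] at hsharp
  have hsq : a.inner p (n p) (N p) ^ 2 = cFun a β p ^ 2 := by
    rw [cFun_sq (hβ1 p)]
    linear_combination hsharp - hself
  exact (pow_left_inj₀ (hn.same_side p).le (cFun_pos (hβ1 p)).le two_ne_zero).1 hsq

theorem IsFinslerNormal.eq_smul_sub : n = cFun a β • N - sharpField a β := by
  ext1 p
  refine inner_ext (a := a) fun w => ?_
  have h := hn.inner_add_form hN hβ1 hβN w
  rw [hn.inner_normal hN hβ1 hβN] at h
  simp only [Pi.sub_apply, Pi.smul_apply', map_sub, map_smul, sub_apply, smul_apply, smul_eq_mul,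
    inner_sharpField]
  linear_combination h

theorem IsFinslerNormal.one_add_form : 1 + β p (n p) = cFun a β p ^ 2 := by
  have h := hn.inner_add_form hN hβ1 hβN (n p)
  rwa [hn.unit, a.symm p (N p), hn.inner_normal hN hβ1 hβN, ← sq] at h

theorem IsFinslerNormal.finslerUnit_eq :
    finslerUnit a β n = (fun q => (cFun a β q ^ 2)⁻¹) • n := by
  ext1 q
  rw [finslerUnit, randersNorm, hn.unit, Real.sqrt_one, hn.one_add_form hN hβ1 hβN]
  rfl

theorem IsFinslerNormal.inducedMetric_eq (u v : TangentSpace (𝓡 (m + 1)) p) :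
    inducedMetric a β n p u v =
      cFun a β p ^ 2 * (a.inner p u v - a.inner p (n p) u * a.inner p (n p) v
        + a.inner p (N p) u * a.inner p (N p) v) := by
  rw [inducedMetric, fundamentalForm_randersNorm (hn.unit p), hn.one_add_form hN hβ1 hβN,
    hn.inner_add_form hN hβ1 hβN, hn.inner_add_form hN hβ1 hβN, hn.inner_normal hN hβ1 hβN]
  ring

theorem IsFinslerNormal.inducedMetric_symm (u v : TangentSpace (𝓡 (m + 1)) p) :
    inducedMetric a β n p u v = inducedMetric a β n p v u := by
  rw [hn.inducedMetric_eq hN hβ1 hβN, hn.inducedMetric_eq hN hβ1 hβN, a.symm p u]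
  ring

theorem IsFinslerNormal.inducedMetric_of_normal {u v : TangentSpace (𝓡 (m + 1)) p}
    (hv : a.inner p (N p) v = 0) :
    inducedMetric a β n p u v =
      cFun a β p ^ 2 * (a.inner p u v - a.inner p (n p) u * a.inner p (n p) v) := by
  rw [hn.inducedMetric_eq hN hβ1 hβN, hv, mul_zero, add_zero]

theorem IsFinslerNormal.inducedMetric_self_left (w : TangentSpace (𝓡 (m + 1)) p) :
    inducedMetric a β n p (n p) w = cFun a β p ^ 3 * a.inner p (N p) w := by
  rw [hn.inducedMetric_eq hN hβ1 hβN, hn.unit, a.symm p (N p) (n p), hn.inner_normal hN hβ1 hβN]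
  ring

theorem IsFinslerNormal.inducedMetric_finslerUnit (w : TangentSpace (𝓡 (m + 1)) p) :
    inducedMetric a β n p (finslerUnit a β n p) w = cFun a β p * a.inner p (N p) w := by
  have hc := (cFun_pos (hβ1 p)).ne'
  have hself := hn.inducedMetric_self_left hN hβ1 hβN w
  rw [hn.inducedMetric_eq hN hβ1 hβN] at hself
  rw [hn.inducedMetric_eq hN hβ1 hβN, hn.finslerUnit_eq hN hβ1 hβN, Pi.smul_apply']
  simp only [map_smul, smul_apply, smul_eq_mul]
  field_simp at hself ⊢
  linear_combination hself

theorem IsFinslerNormal.inducedMetric_finslerUnit_self (p : M) :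
    inducedMetric a β n p (finslerUnit a β n p) (finslerUnit a β n p) = 1 := by
  have hc := (cFun_pos (hβ1 p)).ne'
  rw [hn.inducedMetric_finslerUnit hN hβ1 hβN, hn.finslerUnit_eq hN hβ1 hβN, Pi.smul_apply',
    map_smul, a.symm, hn.inner_normal hN hβ1 hβN, smul_eq_mul]
  field_simp

end FinslerNormal

section FinslerNormalDeriv

variable {D Dg : Connection m M} {u v : TangentSpace (𝓡 (m + 1)) p}

theorem IsLeviCivita.cFun_mul_mvfderiv_cFun (hD : IsLeviCivita (fun p u v => a.inner p u v) D)
    (hβ1 : ∀ p, formNorm a β p < 1) (hb : DifferentiableFieldAt (sharpField a β) p)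
    (w : TangentSpace (𝓡 (m + 1)) p) :
    cFun a β p * mvfderiv (𝓡 (m + 1)) (cFun a β) p w = -β p (D (sharpField a β) p w) := by
  have hc := mdifferentiableAt_cFun (hβ1 p) hb
  have hsq : cFun a β * cFun a β =
      (fun _ => 1) - fun q => a.inner q (sharpField a β q) (sharpField a β q) := by
    ext q
    rw [Pi.mul_apply, ← sq, cFun_sq (hβ1 q), Pi.sub_apply, inner_sharpField]
  have h := congrArg (fun f => mvfderiv (𝓡 (m + 1)) f p w) hsq
  rw [mvfderiv_mul hc hc, mvfderiv_sub mdifferentiableAt_const (mdifferentiableAt_inner a hb hb),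
    mvfderiv_const] at h
  simp only [add_apply, sub_apply, smul_apply, smul_eq_mul, zero_apply] at h
  rw [hD.2 _ _ p hb hb w] at h
  simp only [inner_sharpField, inner_sharpField_right] at h
  linarith

variable (hN : IsUnitNormal a ℱ N) (hn : IsFinslerNormal a β ℱ N n) (hβ1 : ∀ p, formNorm a β p < 1)
  (hβN : ∀ p, β p (N p) = 0) (hb : DifferentiableFieldAt (sharpField a β) p)

include hN hn hβ1 hβN hb

theorem IsFinslerNormal.differentiableFieldAt : DifferentiableFieldAt n p := by
  rw [hn.eq_smul_sub hN hβ1 hβN]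
  exact mdifferentiableAt_sub_section
    ((mdifferentiableAt_cFun (hβ1 p) hb).smul_section (hN.differentiableFieldAt p)) hb

theorem IsFinslerNormal.deriv_eq (D : Connection m M) (w : TangentSpace (𝓡 (m + 1)) p) :
    D n p w = cFun a β p • D N p w + mvfderiv (𝓡 (m + 1)) (cFun a β) p w • N p
      - D (sharpField a β) p w := by
  have hc := mdifferentiableAt_cFun (hβ1 p) hb
  have hNp := hN.differentiableFieldAt p
  rw [hn.eq_smul_sub hN hβ1 hβN, Connection.sub D (hc.smul_section hNp) hb,
    D.isCovariantDerivativeOnUniv.leibniz hNp hc]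
  rfl

theorem IsFinslerNormal.inner_deriv_self (hD : IsLeviCivita (fun p u v => a.inner p u v) D)
    (w : TangentSpace (𝓡 (m + 1)) p) : a.inner p (n p) (D n p w) = 0 := by
  have hnp := hn.differentiableFieldAt hN hβ1 hβN hb
  have h := hD.deriv_add_eq_zero_of_const hnp hnp hn.unit w
  rw [a.symm p (D n p w)] at h
  linarith

theorem IsFinslerNormal.inner_deriv (hv : v ∈ ℱ.tangent p)
    (w : TangentSpace (𝓡 (m + 1)) p) :
    a.inner p (D n p w) v = cFun a β p * a.inner p (D N p w) v
      - a.inner p (D (sharpField a β) p w) v := by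
  rw [hn.deriv_eq hN hβ1 hβN hb]
  simp only [map_sub, map_add, map_smul, sub_apply, add_apply, smul_apply, smul_eq_mul,
    hN.normal p v hv, mul_zero, add_zero]

theorem IsFinslerNormal.mvfderiv_inducedMetric
    (hD : IsLeviCivita (fun p u v => a.inner p u v) D) {X Y : VField m M}
    (hX : DifferentiableFieldAt X p) (hY : DifferentiableFieldAt Y p)
    (hNY : ∀ q, a.inner q (N q) (Y q) = 0) (w : TangentSpace (𝓡 (m + 1)) p) :
    mvfderiv (𝓡 (m + 1)) (fun q => inducedMetric a β n q (X q) (Y q)) p w =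
      2 * cFun a β p * mvfderiv (𝓡 (m + 1)) (cFun a β) p w
          * (a.inner p (X p) (Y p) - a.inner p (n p) (X p) * a.inner p (n p) (Y p))
        + cFun a β p ^ 2 * (a.inner p (D X p w) (Y p) + a.inner p (X p) (D Y p w)
          - (a.inner p (D n p w) (X p) + a.inner p (n p) (D X p w)) * a.inner p (n p) (Y p)
          - a.inner p (n p) (X p) * (a.inner p (D n p w) (Y p) + a.inner p (n p) (D Y p w))) := by
  have hnp := hn.differentiableFieldAt hN hβ1 hβN hb
  have hc := mdifferentiableAt_cFun (hβ1 p) hb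
  have hXY := mdifferentiableAt_inner a hX hY
  have hnX := mdifferentiableAt_inner a hnp hX
  have hnY := mdifferentiableAt_inner a hnp hY
  have hg : (fun q => inducedMetric a β n q (X q) (Y q)) = cFun a β * cFun a β *
      ((fun q => a.inner q (X q) (Y q))
        - (fun q => a.inner q (n q) (X q)) * fun q => a.inner q (n q) (Y q)) := by
    ext q
    rw [hn.inducedMetric_of_normal hN hβ1 hβN (hNY q), sq]
    rfl
  rw [hg, mvfderiv_mul (hc.mul hc) (hXY.sub (hnX.mul hnY)), mvfderiv_mul hc hc,
    mvfderiv_sub hXY (hnX.mul hnY), mvfderiv_mul hnX hnY]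
  simp only [add_apply, sub_apply, smul_apply, smul_eq_mul, Pi.mul_apply, Pi.sub_apply,
    hD.2 _ _ p hX hY w, hD.2 _ _ p hnp hX w, hD.2 _ _ p hnp hY w]
  ring

theorem IsFinslerNormal.two_mul_inducedMetric_deriv
    (hD : IsLeviCivita (fun p u v => a.inner p u v) D) (hDg : IsLeviCivita (inducedMetric a β n) Dg)
    (hu : u ∈ ℱ.tangent p) (hv : v ∈ ℱ.tangent p) :
    2 * inducedMetric a β n p (Dg n p u) v =
      2 * cFun a β p * mvfderiv (𝓡 (m + 1)) (cFun a β) p (n p)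
          * (a.inner p u v - a.inner p (n p) u * a.inner p (n p) v)
        + cFun a β p ^ 2 * (a.inner p (D n p u) v + a.inner p (D n p v) u
          - a.inner p (D n p (n p)) u * a.inner p (n p) v
          - a.inner p (n p) u * a.inner p (D n p (n p)) v) := by
  obtain ⟨X, hX, rfl, hNX⟩ := hN.exists_tangent_extension hu
  obtain ⟨Y, hY, rfl, hNY⟩ := hN.exists_tangent_extension hv
  have hnp := hn.differentiableFieldAt hN hβ1 hβN hb
  have hsub : ∀ u v w : TangentSpace (𝓡 (m + 1)) p, inducedMetric a β n p (u - v) w =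
      inducedMetric a β n p u w - inducedMetric a β n p v w := fun u v w => by
    simp only [hn.inducedMetric_eq hN hβ1 hβN, map_sub, sub_apply]
    ring
  have hnormal : ∀ {q w}, a.inner q (N q) w = 0 → inducedMetric a β n q (n q) w = 0 :=
    fun h => by rw [hn.inducedMetric_self_left hN hβ1 hβN, h, mul_zero]
  have hkoszul := hDg.two_mul_deriv_normal (hn.inducedMetric_symm hN hβ1 hβN) hsub hnp hX hY
    (fun q => hnormal (hNX q)) (fun q => hnormal (hNY q))
    (hnormal (hN.inner_mlieBracket hX hY hNX hNY))
  rw [hkoszul, hn.mvfderiv_inducedMetric hN hβ1 hβN hb hD hX hY hNY, ← hD.torsion_free hnp hX,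
    ← hD.torsion_free hnp hY, hn.inducedMetric_of_normal hN hβ1 hβN (hNY p),
    hn.inducedMetric_of_normal hN hβ1 hβN (hNX p), a.symm p (X p) (D Y p (n p))]
  simp only [map_sub, sub_apply, hn.inner_deriv_self hN hβ1 hβN hb hD]
  ring

theorem IsFinslerNormal.differentiableFieldAt_finslerUnit :
    DifferentiableFieldAt (finslerUnit a β n) p := by
  rw [hn.finslerUnit_eq hN hβ1 hβN]
  exact (mdifferentiableAt_inv_cFun_sq (hβ1 p) hb).smul_section
    (hn.differentiableFieldAt hN hβ1 hβN hb)

theorem IsFinslerNormal.deriv_finslerUnit_mem (hDg : IsLeviCivita (inducedMetric a β n) Dg)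
    (w : TangentSpace (𝓡 (m + 1)) p) : Dg (finslerUnit a β n) p w ∈ ℱ.tangent p := by
  have hν := hn.differentiableFieldAt_finslerUnit hN hβ1 hβN hb
  have hderiv := hDg.deriv_add_eq_zero_of_const hν hν
    (hn.inducedMetric_finslerUnit_self hN hβ1 hβN) w
  rw [hn.inducedMetric_symm hN hβ1 hβN, hn.inducedMetric_finslerUnit hN hβ1 hβN,
    ← two_mul] at hderiv
  rw [hN.mem_tangent_iff]
  simpa [(cFun_pos (hβ1 p)).ne'] using hderiv

theorem IsFinslerNormal.inducedMetric_deriv_finslerUnit (hv : v ∈ ℱ.tangent p)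
    (w : TangentSpace (𝓡 (m + 1)) p) :
    cFun a β p ^ 2 * inducedMetric a β n p (Dg (finslerUnit a β n) p w) v =
      inducedMetric a β n p (Dg n p w) v := by
  have hc := (cFun_pos (hβ1 p)).ne'
  have hv' := hN.normal p v hv
  rw [hn.inducedMetric_of_normal hN hβ1 hβN hv', hn.inducedMetric_of_normal hN hβ1 hβN hv',
    hn.finslerUnit_eq hN hβ1 hβN, Dg.isCovariantDerivativeOnUniv.leibniz
    (hn.differentiableFieldAt hN hβ1 hβN hb) (mdifferentiableAt_inv_cFun_sq (hβ1 p) hb)]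
  simp only [add_apply, map_add, map_smul, smul_apply, smul_eq_mul,
    ContinuousLinearMap.smulRight_apply, hn.unit]
  field_simp
  ring

end FinslerNormalDeriv

section Shape

variable {D Dg : Connection m M} {u v : TangentSpace (𝓡 (m + 1)) p}

theorem IsUnitNormal.eq_of_inner_eq (hN : IsUnitNormal a ℱ N) {x y : TangentSpace (𝓡 (m + 1)) p}
    (hx : x ∈ ℱ.tangent p) (hy : y ∈ ℱ.tangent p)
    (h : ∀ v ∈ ℱ.tangent p, a.inner p x v = a.inner p y v) : x = y := by
  refine inner_ext (a := a) fun w => ?_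
  have hw := h _ (hN.tang_mem w)
  rwa [a.symm p x, a.symm p y, inner_tang (hN.normal p x hx), inner_tang (hN.normal p y hy),
    a.symm p w, a.symm p w] at hw

theorem IsUnitNormal.sharpField_mem (hN : IsUnitNormal a ℱ N) (hβN : β p (N p) = 0) :
    sharpField a β p ∈ ℱ.tangent p := by
  rw [hN.mem_tangent_iff, inner_sharpField_right, hβN]

theorem IsUnitNormal.shape_mem (hN : IsUnitNormal a ℱ N)
    (hD : IsLeviCivita (fun p u v => a.inner p u v) D) (w : TangentSpace (𝓡 (m + 1)) p) :
    shape D N p w ∈ ℱ.tangent p := by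
  rw [hN.mem_tangent_iff, shape, map_neg, hN.inner_deriv_self hD, neg_zero]

theorem IsUnitNormal.inner_shape_symm (hN : IsUnitNormal a ℱ N)
    (hD : IsLeviCivita (fun p u v => a.inner p u v) D) (hu : u ∈ ℱ.tangent p)
    (hv : v ∈ ℱ.tangent p) :
    a.inner p (shape D N p u) v = a.inner p (shape D N p v) u := by
  rw [shape, shape, map_neg, map_neg, neg_apply, neg_apply, hN.inner_deriv_symm hD hu hv]

-- Sherman–Morrison: `id - β♯ ⊗ β` has inverse `id + c⁻² β♯ ⊗ β`, because `1 - β(β♯) = c²`.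
theorem IsUnitNormal.eq_add_smul_sharpField (hN : IsUnitNormal a ℱ N) (hβN : β p (N p) = 0)
    (hβ1 : formNorm a β p < 1) {x r : TangentSpace (𝓡 (m + 1)) p}
    (hx : x ∈ ℱ.tangent p) (hr : r ∈ ℱ.tangent p)
    (h : ∀ v ∈ ℱ.tangent p, a.inner p x v - β p x * β p v = a.inner p r v) :
    x = r + ((cFun a β p ^ 2)⁻¹ * β p r) • sharpField a β p := by
  have hb := hN.sharpField_mem hβN
  have hc := (cFun_pos hβ1).ne'
  have hform : cFun a β p ^ 2 * β p x = β p r := by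
    have hsharp := h _ hb
    rw [inner_sharpField_right, inner_sharpField_right] at hsharp
    rw [cFun_sq hβ1]
    linear_combination hsharp
  refine hN.eq_of_inner_eq hx (add_mem hr (Submodule.smul_mem _ _ hb)) fun v hv => ?_
  rw [map_add, map_smul, add_apply, smul_apply, inner_sharpField, ← h v hv, ← hform,
    inv_mul_cancel_left₀ (pow_ne_zero 2 hc), smul_eq_mul, sub_add_cancel]

/-- The vector `c Z̄ + Ā(β♯) - (D_{N - c⁻¹ β♯} β♯)^⊤`, the leaf component of `c⁻¹ D_n n` for the
field `n = c N - β♯`. -/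
noncomputable def leafAcceleration (a : Metric m M) (D : Connection m M) (β : OneForm m M)
    (N : VField m M) (p : M) : TangentSpace (𝓡 (m + 1)) p :=
  cFun a β p • curvVec D N p + shape D N p (sharpField a β p) - transDeriv a D β N p

theorem IsUnitNormal.leafAcceleration_mem (hN : IsUnitNormal a ℱ N)
    (hD : IsLeviCivita (fun p u v => a.inner p u v) D) :
    leafAcceleration a D β N p ∈ ℱ.tangent p :=
  sub_mem (add_mem (Submodule.smul_mem _ _ (hN.mem_tangent_iff.2 (hN.inner_deriv_self hD _)))
    (hN.shape_mem hD _)) (hN.tang_mem _)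

theorem IsLeviCivita.form_leafAcceleration (hD : IsLeviCivita (fun p u v => a.inner p u v) D)
    (hβ1 : ∀ p, formNorm a β p < 1) (hβN : β p (N p) = 0)
    (hb : DifferentiableFieldAt (sharpField a β) p) :
    β p (leafAcceleration a D β N p) = cFun a β p * β p (curvVec D N p)
      + β p (shape D N p (sharpField a β p)) + derivC a β N p := by
  have hc := (cFun_pos (hβ1 p)).ne'
  have htransDeriv : β p (transDeriv a D β N p) = -derivC a β N p := by
    have h := hD.cFun_mul_mvfderiv_cFun hβ1 hb (N p - (cFun a β p)⁻¹ • sharpField a β p)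
    rw [transDeriv, form_tang hβN, derivC]
    simp only [map_sub, map_smul, smul_eq_mul] at h ⊢
    field_simp at h ⊢
    linear_combination h
  rw [leafAcceleration, map_sub, map_add, map_smul, htransDeriv, sub_neg_eq_add, smul_eq_mul]

theorem IsUnitNormal.exists_inner_U₁_eq_and_U₂_eq (hN : IsUnitNormal a ℱ N)
    (hβ1 : ∀ p, formNorm a β p < 1) (hβN : β p (N p) = 0)
    (hb : DifferentiableFieldAt (sharpField a β) p)
    (hD : IsLeviCivita (fun p u v => a.inner p u v) D) (hu : u ∈ ℱ.tangent p) :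
    ∃ k : ℝ,
      a.inner p (U₁ a D β N p) u = (cFun a β p ^ 2)⁻¹ *
          (a.inner p (shape D N p (sharpField a β p)) u
            + (cFun a β p)⁻¹ * a.inner p (deform a D (sharpField a β) p (sharpField a β p)) u
            - 1 / 2 * (a.inner p (leafAcceleration a D β N p) u
              + β p (leafAcceleration a D β N p) * β p u))
          - 1 / 2 * k * β p u ∧
      U₂ a D β N p = (1 / 2 : ℝ) • (k • sharpField a β p - leafAcceleration a D β N p) := by
  obtain ⟨k, hperp, hk⟩ := exists_perpForm_eq (hβ1 p) (shape D N p (sharpField a β p))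
  have hc := (cFun_pos (hβ1 p)).ne'
  refine ⟨k, ?_, ?_⟩
  · rw [hD.form_leafAcceleration hβ1 hβN hb, hk, U₁, leafAcceleration, hperp]
    simp only [map_smul, map_sub, map_add, smul_apply, sub_apply, add_apply, smul_eq_mul,
      inner_sharpField, inner_tang (hN.normal p u hu)]
    field_simp
    ring
  · rw [U₂, leafAcceleration, hperp]
    module

variable (hN : IsUnitNormal a ℱ N) (hn : IsFinslerNormal a β ℱ N n) (hβ1 : ∀ p, formNorm a β p < 1)
  (hβN : ∀ p, β p (N p) = 0) (hb : DifferentiableFieldAt (sharpField a β) p)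

include hN hn hβ1 hβN hb

theorem IsFinslerNormal.inner_deriv_eq_inner_leafAcceleration (hv : v ∈ ℱ.tangent p) :
    a.inner p (D n p (n p)) v = cFun a β p * a.inner p (leafAcceleration a D β N p) v := by
  have hc := (cFun_pos (hβ1 p)).ne'
  rw [hn.inner_deriv hN hβ1 hβN hb hv, hn.eq_smul_sub hN hβ1 hβN]
  simp only [leafAcceleration, curvVec, shape, transDeriv, Pi.sub_apply, Pi.smul_apply', map_sub,
    map_add, map_neg, map_smul, sub_apply, add_apply, neg_apply, smul_apply, smul_eq_mul,
    inner_tang (hN.normal p v hv)]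
  field_simp
  ring

theorem IsFinslerNormal.inner_deriv_add_inner_deriv
    (hD : IsLeviCivita (fun p u v => a.inner p u v) D) (hu : u ∈ ℱ.tangent p)
    (hv : v ∈ ℱ.tangent p) :
    a.inner p (D n p u) v + a.inner p (D n p v) u =
      -2 * (cFun a β p * a.inner p (shape D N p u) v
        + a.inner p (deform a D (sharpField a β) p u) v) := by
  have hdeform := two_mul_inner_deform (a := a) D (sharpField a β) u v
  rw [a.symm p u] at hdeform
  rw [hn.inner_deriv hN hβ1 hβN hb hv, hn.inner_deriv hN hβ1 hβN hb hu,
    ← hN.inner_deriv_symm hD hu hv, shape, map_neg, neg_apply]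
  linear_combination hdeform

theorem IsFinslerNormal.inner_shape_finslerUnit
    (hD : IsLeviCivita (fun p u v => a.inner p u v) D) (hDg : IsLeviCivita (inducedMetric a β n) Dg)
    (hu : u ∈ ℱ.tangent p) (hv : v ∈ ℱ.tangent p) :
    cFun a β p * (a.inner p (shape Dg (finslerUnit a β n) p u) v
        - β p (shape Dg (finslerUnit a β n) p u) * β p v) =
      a.inner p (shape D N p u) v
        - (cFun a β p ^ 2)⁻¹ * derivC a β N p * (a.inner p u v - β p u * β p v)
        + (cFun a β p)⁻¹ * a.inner p (deform a D (sharpField a β) p u) v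
        - 1 / 2 * (a.inner p (leafAcceleration a D β N p) u * β p v
          + β p u * a.inner p (leafAcceleration a D β N p) v) := by
  have hc := (cFun_pos (hβ1 p)).ne'
  have hform : ∀ w ∈ ℱ.tangent p, a.inner p (n p) w = -β p w := fun w hw =>
    eq_neg_of_add_eq_zero_left (hn.inner_add_form_of_mem (hβ1 p) hw)
  have hderivC : mvfderiv (𝓡 (m + 1)) (cFun a β) p (n p) = derivC a β N p := by
    rw [congrFun (hn.eq_smul_sub hN hβ1 hβN) p]
    rfl
  have hg := hn.two_mul_inducedMetric_deriv hN hβ1 hβN hb hD hDg hu hv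
  rw [← hn.inducedMetric_deriv_finslerUnit hN hβ1 hβN hb hv,
    hn.inducedMetric_of_normal hN hβ1 hβN (hN.normal p v hv),
    hform _ (hn.deriv_finslerUnit_mem hN hβ1 hβN hb hDg u), hform u hu, hform v hv, hderivC,
    hn.inner_deriv_eq_inner_leafAcceleration hN hβ1 hβN hb hu,
    hn.inner_deriv_eq_inner_leafAcceleration hN hβ1 hβN hb hv,
    hn.inner_deriv_add_inner_deriv hN hβ1 hβN hb hD hu hv] at hg
  rw [shape, map_neg, map_neg, neg_apply]
  field_simp at hg ⊢
  linear_combination -hg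

theorem IsFinslerNormal.cFun_smul_shape_finslerUnit_eq_leafAcceleration
    (hD : IsLeviCivita (fun p u v => a.inner p u v) D) (hDg : IsLeviCivita (inducedMetric a β n) Dg)
    (hu : u ∈ ℱ.tangent p) :
    cFun a β p • shape Dg (finslerUnit a β n) p u =
      shape D N p u - ((cFun a β p ^ 2)⁻¹ * derivC a β N p) • u
        + (cFun a β p)⁻¹ • tang a N p (deform a D (sharpField a β) p u)
        - (1 / 2 * β p u) • leafAcceleration a D β N p
        + ((cFun a β p ^ 2)⁻¹ * (a.inner p (shape D N p (sharpField a β p)) u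
          + (cFun a β p)⁻¹ * a.inner p (deform a D (sharpField a β) p (sharpField a β p)) u
          - 1 / 2 * (a.inner p (leafAcceleration a D β N p) u
            + β p (leafAcceleration a D β N p) * β p u))) • sharpField a β p := by
  have hc := (cFun_pos (hβ1 p)).ne'
  have hb' := hN.sharpField_mem (hβN p)
  have hshape : β p (shape D N p u) = a.inner p (shape D N p (sharpField a β p)) u := by
    rw [← inner_sharpField_right a, hN.inner_shape_symm hD hu hb']
  have hdeform : β p (tang a N p (deform a D (sharpField a β) p u)) =
      a.inner p (deform a D (sharpField a β) p (sharpField a β p)) u := by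
    rw [form_tang (hβN p), ← inner_sharpField_right a, inner_deform_symm]
  have hsharp : β p (sharpField a β p) = 1 - cFun a β p ^ 2 := by
    rw [cFun_sq (hβ1 p), sub_sub_cancel]
  set r := shape D N p u - ((cFun a β p ^ 2)⁻¹ * derivC a β N p) • (u - β p u • sharpField a β p)
    + (cFun a β p)⁻¹ • tang a N p (deform a D (sharpField a β) p u)
    - (1 / 2 : ℝ) • (a.inner p (leafAcceleration a D β N p) u • sharpField a β p
      + β p u • leafAcceleration a D β N p) with hr
  have hr_mem : r ∈ ℱ.tangent p :=
    sub_mem (add_mem (sub_mem (hN.shape_mem hD u)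
      (Submodule.smul_mem _ _ (sub_mem hu (Submodule.smul_mem _ _ hb'))))
      (Submodule.smul_mem _ _ (hN.tang_mem _)))
      (Submodule.smul_mem _ _ (add_mem (Submodule.smul_mem _ _ hb')
        (Submodule.smul_mem _ _ (hN.leafAcceleration_mem hD))))
  have hx_mem : cFun a β p • shape Dg (finslerUnit a β n) p u ∈ ℱ.tangent p :=
    Submodule.smul_mem _ _ (neg_mem (hn.deriv_finslerUnit_mem hN hβ1 hβN hb hDg u))
  rw [hN.eq_add_smul_sharpField (hβN p) (hβ1 p) hx_mem hr_mem fun v hv => ?_]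
  · simp only [hr, map_sub, map_add, map_smul, smul_eq_mul, hshape, hdeform, hsharp]
    match_scalars <;> field_simp
    ring
  · have h := hn.inner_shape_finslerUnit hN hβ1 hβN hb hD hDg hu hv
    simp only [hr, map_sub, map_add, map_smul, sub_apply, add_apply, smul_apply, smul_eq_mul,
      inner_sharpField, inner_tang (hN.normal p v hv)]
    linear_combination h

theorem IsFinslerNormal.cFun_smul_shape_finslerUnit
    (hD : IsLeviCivita (fun p u v => a.inner p u v) D) (hDg : IsLeviCivita (inducedMetric a β n) Dg)
    (hu : u ∈ ℱ.tangent p) :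
    cFun a β p • shape Dg (finslerUnit a β n) p u =
      shape D N p u - ((cFun a β p ^ 2)⁻¹ * derivC a β N p) • u
        + (cFun a β p)⁻¹ • tang a N p (deform a D (sharpField a β) p u)
        + a.inner p (U₁ a D β N p) u • sharpField a β p + β p u • U₂ a D β N p := by
  obtain ⟨k, hU₁, hU₂⟩ := hN.exists_inner_U₁_eq_and_U₂_eq hβ1 (hβN p) hb hD hu
  rw [hn.cFun_smul_shape_finslerUnit_eq_leafAcceleration hN hβ1 hβN hb hD hDg hu, hU₁, hU₂]
  module

end Shape

section SpecialCases

variable {D : Connection m M}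

theorem derivC_eq_zero_of_formNorm_const {k : ℝ} (h : ∀ q, formNorm a β q = k) (N : VField m M)
    (p : M) : derivC a β N p = 0 := by
  have hc : cFun a β = fun _ => Real.sqrt (1 - k ^ 2) := by
    ext q
    rw [cFun, h]
  rw [derivC, hc, mvfderiv_const, zero_apply]

theorem U₁_of_derivC_eq_zero (D : Connection m M) (h : derivC a β N p = 0) :
    U₁ a D β N p = (1 / 2 * (cFun a β p ^ 2)⁻¹ : ℝ) •
      ((2 * (cFun a β p)⁻¹) • tang a N p (deform a D (sharpField a β) p (sharpField a β p))
        + transDeriv a D β N p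
        + perpForm a β p (shape D N p (sharpField a β p))
        - cFun a β p • curvVec D N p
        - (cFun a β p * a.inner p (curvVec D N p) (sharpField a β p)) • sharpField a β p) := by
  rw [U₁, h, inner_sharpField_right]
  module

theorem IsParallelForm.deriv_sharpField (h : IsParallelForm D β)
    (hD : IsLeviCivita (fun p u v => a.inner p u v) D)
    (hb : DifferentiableFieldAt (sharpField a β) p) : D (sharpField a β) p = 0 := by
  ext1 v
  refine inner_ext (a := a) fun w => ?_
  have hw : DifferentiableFieldAt (FiberBundle.extend (Model m) w) p :=
    FiberBundle.mdifferentiableAt_extend (𝓡 (m + 1)) (Model m) w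
  have hmetric := hD.2 _ _ p hb hw v
  have hparallel := h _ p hw v
  simp only [inner_sharpField, FiberBundle.extend_apply_self] at hmetric
  rw [zero_apply, map_zero, zero_apply]
  linarith

theorem tang_zero (a : Metric m M) (N : VField m M) (p : M) : tang a N p 0 = 0 := by
  simp [tang]

theorem deform_eq_zero (a : Metric m M) {ξ : VField m M} (h : D ξ p = 0)
    (u : TangentSpace (𝓡 (m + 1)) p) : deform a D ξ p u = 0 := by
  refine inner_ext (a := a) fun w => ?_
  have hw := two_mul_inner_deform (a := a) D ξ u w
  rw [h] at hw
  simpa using hw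

theorem transDeriv_eq_zero (h : D (sharpField a β) p = 0) (N : VField m M) :
    transDeriv a D β N p = 0 := by
  rw [transDeriv, h, zero_apply, tang_zero]

theorem IsLeviCivita.derivC_eq_zero (hD : IsLeviCivita (fun p u v => a.inner p u v) D)
    (hβ1 : ∀ p, formNorm a β p < 1) (hb : DifferentiableFieldAt (sharpField a β) p)
    (h : D (sharpField a β) p = 0) (N : VField m M) : derivC a β N p = 0 := by
  have hc := hD.cFun_mul_mvfderiv_cFun hβ1 hb (cFun a β p • N p - sharpField a β p)
  rw [h, zero_apply, map_zero, neg_zero] at hc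
  exact (mul_eq_zero.1 hc).resolve_left (cFun_pos (hβ1 p)).ne'

end SpecialCases

theorem proposition3_general (hβ1 : ∀ p, formNorm a β p < 1) (hN : IsUnitNormal a ℱ N)
    (hβN : ∀ p, β p (N p) = 0) (hn : IsFinslerNormal a β ℱ N n) {D Dg : Connection m M}
    (hD : IsLeviCivita (fun p u v => a.inner p u v) D) (hDg : IsLeviCivita (inducedMetric a β n) Dg)
    (hb : DifferentiableFieldAt (sharpField a β) p) {u : TangentSpace (𝓡 (m + 1)) p}
    (hu : u ∈ ℱ.tangent p) :
    (cFun a β p • shape Dg (finslerUnit a β n) p u =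
      shape D N p u - ((cFun a β p ^ 2)⁻¹ * derivC a β N p) • u
        + (cFun a β p)⁻¹ • tang a N p (deform a D (sharpField a β) p u)
        + a.inner p (U₁ a D β N p) u • sharpField a β p + β p u • U₂ a D β N p) ∧
    (derivC a β N p = 0 →
      cFun a β p • shape Dg (finslerUnit a β n) p u =
        shape D N p u
          + (cFun a β p)⁻¹ • tang a N p (deform a D (sharpField a β) p u)
          + β p u • U₂ a D β N p
          + a.inner p ((1 / 2 * (cFun a β p ^ 2)⁻¹ : ℝ) •
              ((2 * (cFun a β p)⁻¹) •
                  tang a N p (deform a D (sharpField a β) p (sharpField a β p))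
                + transDeriv a D β N p
                + perpForm a β p (shape D N p (sharpField a β p))
                - cFun a β p • curvVec D N p
                - (cFun a β p * a.inner p (curvVec D N p) (sharpField a β p)) •
                    sharpField a β p)) u • sharpField a β p) ∧
    (D (sharpField a β) p = 0 →
      cFun a β p • shape Dg (finslerUnit a β n) p u =
        shape D N p u
          - β p u • ((1 / 2 : ℝ) •
              (perpForm a β p (shape D N p (sharpField a β p)) + cFun a β p • curvVec D N p))
          + a.inner p ((1 / 2 * (cFun a β p ^ 2)⁻¹ : ℝ) •
              (perpForm a β p (shape D N p (sharpField a β p))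
                - cFun a β p • curvVec D N p
                - (cFun a β p * a.inner p (curvVec D N p) (sharpField a β p)) •
                    sharpField a β p)) u • sharpField a β p) := by
  have general := hn.cFun_smul_shape_finslerUnit hN hβ1 hβN hb hD hDg hu
  refine ⟨general, fun hderivC => ?_, fun hparallel => ?_⟩
  · rw [general, U₁_of_derivC_eq_zero D hderivC, hderivC]
    module
  · have hderivC := hD.derivC_eq_zero hβ1 hb hparallel N
    rw [general, U₁_of_derivC_eq_zero D hderivC, hderivC, U₂, transDeriv_eq_zero hparallel,
      deform_eq_zero a hparallel, deform_eq_zero a hparallel, tang_zero, smul_zero, smul_zero,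
      zero_add, zero_add]
    module

end RandersFoliation

theorem proposition3 (m : ℕ) {M : Type*} [TopologicalSpace M] [T2Space M] [SigmaCompactSpace M]
    [ChartedSpace (Model m) M] [IsManifold (𝓡 (m + 1)) ∞ M]
    (a : RandersFoliation.Metric m M)
    (β : OneForm m M) (hβ : SmoothForm β) (hβ1 : ∀ p, formNorm a β p < 1)
    (ℱ : CodimOneFoliation m M)
    (N : VField m M) (hN : IsUnitNormal a ℱ N) (hβN : ∀ p, β p (N p) = 0)
    (n : VField m M) (hn : IsFinslerNormal a β ℱ N n)
    (Da : Connection m M) (hDa : IsLeviCivita (fun p u v => a.inner p u v) Da)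
    (Dg : Connection m M) (hDg : IsLeviCivita (inducedMetric a β n) Dg) :
    -- the general formula
    (∀ p, ∀ u ∈ ℱ.tangent p,
      cFun a β p • shape Dg (finslerUnit a β n) p u =
        shape Da N p u
        - ((cFun a β p ^ 2)⁻¹ *
            mvfderiv (𝓡 (m + 1)) (cFun a β) p (cFun a β p • N p - sharpField a β p)) • u
        + (cFun a β p)⁻¹ • tang a N p (deform a Da (sharpField a β) p u)
        + a.inner p (U₁ a Da β N p) u • sharpField a β p
        + β p u • U₂ a Da β N p) ∧
    -- the case of constant `‖β‖_α`
    ((∃ k : ℝ, ∀ p, formNorm a β p = k) →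
      ∀ p, ∀ u ∈ ℱ.tangent p,
        cFun a β p • shape Dg (finslerUnit a β n) p u =
          shape Da N p u
          + (cFun a β p)⁻¹ • tang a N p (deform a Da (sharpField a β) p u)
          + β p u • ((1 / 2 : ℝ) •
              (tang a N p (Da (sharpField a β) p (N p - (cFun a β p)⁻¹ • sharpField a β p))
                - cFun a β p • curvVec Da N p
                - perpForm a β p (shape Da N p (sharpField a β p))))
          + a.inner p ((1 / 2 * (cFun a β p ^ 2)⁻¹ : ℝ) •
              ((2 * (cFun a β p)⁻¹) •
                  tang a N p (deform a Da (sharpField a β) p (sharpField a β p))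
                + tang a N p (Da (sharpField a β) p (N p - (cFun a β p)⁻¹ • sharpField a β p))
                + perpForm a β p (shape Da N p (sharpField a β p))
                - cFun a β p • curvVec Da N p
                - (cFun a β p * a.inner p (curvVec Da N p) (sharpField a β p)) •
                    sharpField a β p)) u • sharpField a β p) ∧
    -- the case of parallel `β`
    (IsParallelForm Da β →
      ∀ p, ∀ u ∈ ℱ.tangent p,
        cFun a β p • shape Dg (finslerUnit a β n) p u =
          shape Da N p u
          - β p u • ((1 / 2 : ℝ) •
              (perpForm a β p (shape Da N p (sharpField a β p))
                + cFun a β p • curvVec Da N p))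
          + a.inner p ((1 / 2 * (cFun a β p ^ 2)⁻¹ : ℝ) •
              (perpForm a β p (shape Da N p (sharpField a β p))
                - cFun a β p • curvVec Da N p
                - (cFun a β p * a.inner p (curvVec Da N p) (sharpField a β p)) •
                    sharpField a β p)) u • sharpField a β p) :=
  have general := fun p (u : TangentSpace (𝓡 (m + 1)) p) (hu : u ∈ ℱ.tangent p) =>
    proposition3_general hβ1 hN hβN hn hDa hDg
      (differentiableFieldAt_sharpField a ((hβ p).mdifferentiableAt (by simp))) hu
  ⟨fun p u hu => (general p u hu).1,
    fun ⟨_, hk⟩ p u hu => (general p u hu).2.1 (derivC_eq_zero_of_formNorm_const hk N p),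
    fun hpar p u hu => (general p u hu).2.2 (hpar.deriv_sharpField hDa
      (differentiableFieldAt_sharpField a ((hβ p).mdifferentiableAt (by simp))))⟩
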